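/- Let $\alpha$ be a real number of constant (bounded) type, i.e. $\alpha$ is irrational and the partial quotients $a_1,a_2,\dots$ of its continued fraction expansion $\alpha=[a_0;a_1,a_2,\dots]$ are bounded. Let $\varphi$ be a real-valued function on $(0,1)$ which is monotone decreasing (not necessarily strictly) and anti-symmetric, i.e. $\varphi(1-x)=-\varphi(x)$ for all $x\in(0,1)$, and which satisfies $\varphi(x)=O(1/x)$ on $(0,\tfrac12)$, i.e. there is a constant $K$ with $|\varphi(x)|\le K/x$ for all $x\in(0,\tfrac12)$. Extend $\varphi$ to a function of period $1$ (its values at the integers play no role). Then $$S_N\varphi:=\sum_{r=1}^{N}\varphi(r\alpha)=O(N),$$ i.e. there is a constant $C$ (depending on $\alpha$ and $\varphi$ only) such that $|S_N\varphi|\le C\,N$ for all integers $N\ge 1$. -/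

import Mathlib

/-- A real number `α` is of constant type if it is irrational and the partial quotients
`a₁, a₂, …` of its continued fraction expansion `α = [a₀; a₁, a₂, …]` are bounded.
(In Mathlib `(GenContFract.of α).partDens` is the sequence `a₁, a₂, …`.) -/
def IsConstantType (α : ℝ) : Prop :=
  Irrational α ∧
    ∃ A : ℝ, ∀ (n : ℕ) (a : ℝ), (GenContFract.of α).partDens.get? n = some a → a ≤ A

/-- The homogeneous Birkhoff sum `S_N φ = ∑_{r=1}^N φ(rα)` over the rotation of the circle
`ℝ/ℤ` through `α`; the circle is read in the coordinate `[0,1)`, so `φ(rα)` is `φ` at the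
fractional part of `rα`. -/
noncomputable def rotationSum (α : ℝ) (φ : ℝ → ℝ) (N : ℕ) : ℝ :=
  ∑ r ∈ Finset.Icc 1 N, φ (Int.fract ((r : ℝ) * α))

/-! Strong induction on `N`, removing a block of last terms whose length is comparable to `N`.
Constant type makes `α` badly approximable, so Dirichlet's theorem with bound `N` yields `p / q`
with `c N ≤ q ≤ N`. Every orbit point up to time `N` is at distance at least `c / N` from the
integers, hence `|φ| ≤ M = K N / c` there. The last `q` points lie close to the grid `k / q`, each
grid point being used once. The grid sum of `φ` vanishes by antisymmetry, and by monotonicity the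
error telescopes to `O(M) = O(q)` (`abs_sum_le_of_near_grid`). The blocks add up to `O(N)`. -/

open Finset

/-! ### Bad approximability from bounded partial quotients -/

namespace GenContFract

/-- The continuants of the continued fraction of a real number are integers. -/
theorem exists_int_contsAux (v : ℝ) (n : ℕ) :
    ∃ a b : ℤ, (GenContFract.of v).contsAux n = ⟨a, b⟩ := by
  induction n using Nat.strong_induction_on with
  | _ n ih =>
    match n with
    | 0 => exact ⟨1, 0, by simp [contsAux]⟩
    | 1 => exact ⟨⌊v⌋, 1, by simp [contsAux]⟩
    | k + 2 =>
      obtain ⟨a, b, h1⟩ := ih k (by omega)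
      obtain ⟨a', b', h2⟩ := ih (k + 1) (by omega)
      rcases hs : (GenContFract.of v).s.get? k with _ | gp
      · exact ⟨a', b', by rw [← h2]; exact contsAux_stable_step_of_terminated hs⟩
      · obtain ⟨ha, z, hz⟩ := of_partNum_eq_one_and_exists_int_partDen_eq hs
        refine ⟨z * a' + a, z * b' + b, ?_⟩
        rw [contsAux_recurrence hs h1 h2, ha, hz]
        push_cast
        simp

/-- The denominator of a convergent is at most the reduced denominator of its value. -/
theorem dens_le_den {v : ℝ} {n : ℕ} (hn : ¬ (GenContFract.of v).TerminatedAt n) {x : ℚ}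
    (hx : (GenContFract.of v).convs n = x) : (GenContFract.of v).dens n ≤ x.den := by
  obtain ⟨a, b, hab⟩ := exists_int_contsAux v (n + 2)
  have hB : 0 ≤ (GenContFract.of v).dens n := zero_le_of_den
  rcases hB.eq_or_lt with h0 | hpos
  · rw [← h0]; positivity
  have hdet := SimpContFract.determinant (s := SimpContFract.of v) hn
  change (GenContFract.of v).nums n * (GenContFract.of v).dens (n + 1) -
      (GenContFract.of v).dens n * (GenContFract.of v).nums (n + 1) = (-1) ^ (n + 1) at hdet
  have hd : (GenContFract.of v).dens (n + 1) = b := by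
    rw [den_eq_conts_b, nth_cont_eq_succ_nth_contAux, hab]
  have hnu : (GenContFract.of v).nums (n + 1) = a := by
    rw [num_eq_conts_a, nth_cont_eq_succ_nth_contAux, hab]
  rw [conv_eq_num_div_den, div_eq_iff hpos.ne'] at hx
  set B := (GenContFract.of v).dens n
  rw [hd, hnu, hx] at hdet
  have hxd : (x : ℝ) * x.den = x.num := by exact_mod_cast Rat.mul_den_eq_num x
  have hden : (0 : ℝ) < x.den := by exact_mod_cast x.pos
  -- The determinant identity with `Aₙ = x Bₙ`, cleared of denominators: `Bₙ` times an integer is `±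
  -- x.den`, so that integer is nonzero.
  have key : B * ((x.num * b - x.den * a : ℤ) : ℝ) = (-1) ^ (n + 1) * x.den := by
    push_cast
    rw [← hdet, ← hxd]
    ring
  have habs : B * |((x.num * b - x.den * a : ℤ) : ℝ)| = x.den := by
    have := congrArg abs key
    rwa [abs_mul, abs_mul, abs_of_pos hpos, abs_of_pos hden, abs_neg_one_pow, one_mul] at this
  have hne : (x.num * b - x.den * a : ℤ) ≠ 0 := by
    intro h
    rw [h, Int.cast_zero, abs_zero, mul_zero] at habs
    exact hden.ne habs
  have h1 : (1 : ℝ) ≤ |((x.num * b - x.den * a : ℤ) : ℝ)| := by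
    exact_mod_cast Int.one_le_abs hne
  nlinarith

/-- A convergent of an irrational number with partial quotients at most `A` is no better an
approximation than `1 / ((A + 2) Bₙ²)`. -/
theorem le_abs_sub_convs {v A : ℝ} (hv : Irrational v)
    (hA : ∀ (n : ℕ) (a : ℝ), (GenContFract.of v).partDens.get? n = some a → a ≤ A) (n : ℕ) :
    ¬ (GenContFract.of v).TerminatedAt n ∧
      1 ≤ (A + 2) * (GenContFract.of v).dens n ^ 2 * |v - (GenContFract.of v).convs n| := by
  have hnt : ∀ k, ¬ (GenContFract.of v).TerminatedAt k := fun k hk =>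
    let ⟨q, hq⟩ := (terminates_iff_rat v).1 ⟨k, hk⟩
    hv ⟨q, hq.symm⟩
  refine ⟨hnt n, ?_⟩
  obtain ⟨i', hi'⟩ := Option.ne_none_iff_exists'.1
    (mt of_terminatedAt_n_iff_succ_nth_intFractPair_stream_eq_none.2 (hnt n))
  obtain ⟨i, hi, hfr, -⟩ := IntFractPair.succ_nth_stream_eq_some_iff.1 hi'
  have hfr0 : 0 < i.fr := lt_of_le_of_ne (IntFractPair.nth_stream_fr_nonneg hi) hfr.symm
  have hfl : ((⌊i.fr⁻¹⌋ : ℤ) : ℝ) ≤ A :=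
    hA n _ (partDen_eq_s_b (get?_of_eq_some_of_get?_intFractPair_stream_fr_ne_zero hi hfr))
  have hinv : i.fr⁻¹ ≤ A + 1 := by linarith [Int.lt_floor_add_one i.fr⁻¹]
  have hB : 1 ≤ (GenContFract.of v).dens n := by
    refine le_trans ?_ (succ_nth_fib_le_of_nth_den (Or.inr (hnt (n - 1))))
    exact_mod_cast Nat.fib_pos.2 n.succ_pos
  have hpB0 : 0 ≤ ((GenContFract.of v).contsAux n).b := zero_le_of_contsAux_b
  have hpB : ((GenContFract.of v).contsAux n).b ≤ (GenContFract.of v).dens n := by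
    rcases n with _ | n
    · simp [contsAux]
    · exact of_den_mono
  have heq := sub_convs_eq hi
  simp only [hfr, if_false] at heq
  -- The error is exactly `1 / (Bₙ (ξ Bₙ + Bₙ₋₁))` with complete quotient `ξ = i.fr⁻¹ ≤ A + 1`, and
  -- `Bₙ₋₁ ≤ Bₙ`.
  rw [heq, ← nth_cont_eq_succ_nth_contAux, ← den_eq_conts_b, abs_div, abs_neg_one_pow]
  set B := (GenContFract.of v).dens n
  set pB := ((GenContFract.of v).contsAux n).b
  have hf1 : 0 < i.fr⁻¹ := inv_pos.2 hfr0
  have hD : 0 < B * (i.fr⁻¹ * B + pB) := by positivity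
  rw [abs_of_pos hD, mul_one_div, le_div_iff₀ hD, one_mul]
  have : i.fr⁻¹ * B + pB ≤ (A + 2) * B := by nlinarith
  nlinarith

end GenContFract

/-- Numbers of constant type are badly approximable. -/
theorem IsConstantType.exists_le_abs_sub {α : ℝ} (hα : IsConstantType α) :
    ∃ c : ℝ, 0 < c ∧ c ≤ 1 ∧ ∀ x : ℚ, c ≤ (x.den : ℝ) ^ 2 * |α - x| := by
  obtain ⟨hirr, A, hA⟩ := hα
  have hA0 : 0 < |A| + 2 := by positivity
  refine ⟨1 / (|A| + 2), by positivity, ?_, fun x => ?_⟩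
  · rw [div_le_one hA0]; linarith [abs_nonneg A]
  have hd : (0 : ℝ) < x.den := by exact_mod_cast x.pos
  -- Legendre: an approximation this close is a convergent; for any other, `1 / 2` already suffices.
  rcases lt_or_ge |α - x| (1 / (2 * (x.den : ℝ) ^ 2)) with h | h
  · obtain ⟨n, hn⟩ := Real.exists_convs_eq_rat h
    obtain ⟨hnt, hle⟩ := GenContFract.le_abs_sub_convs hirr hA n
    have hB := GenContFract.dens_le_den hnt hn
    rw [hn] at hle
    have hB0 : 0 ≤ (GenContFract.of α).dens n := GenContFract.zero_le_of_den
    rw [div_le_iff₀ hA0]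
    calc 1 ≤ (A + 2) * (GenContFract.of α).dens n ^ 2 * |α - x| := hle
      _ ≤ (|A| + 2) * (x.den : ℝ) ^ 2 * |α - x| := by
        gcongr
        exact le_abs_self A
      _ = _ := by ring
  · calc 1 / (|A| + 2) ≤ 1 / 2 := by gcongr; linarith [abs_nonneg A]
      _ = (x.den : ℝ) ^ 2 * (1 / (2 * (x.den : ℝ) ^ 2)) := by field_simp
      _ ≤ _ := by gcongr

/-- The fractional parts of the multiples of a badly approximable number stay away from the
integers. -/
theorem fract_mul_mem_Icc {α c : ℝ} (h : ∀ x : ℚ, c ≤ (x.den : ℝ) ^ 2 * |α - x|) {j : ℕ}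
    (hj : 0 < j) : Int.fract (j * α) ∈ Set.Icc (c / j) (1 - c / j) := by
  have hj' : (0 : ℝ) < j := by exact_mod_cast hj
  have key : ∀ m : ℤ, c / j ≤ |j * α - m| := fun m => by
    have hden : (((m : ℚ) / j).den : ℝ) ≤ j := by
      have h1 : (((m : ℚ) / (j : ℤ)).den : ℤ) ∣ j := by
        rw [← Rat.divInt_eq_div]
        exact Rat.den_dvd m j
      have h2 := Int.le_of_dvd (by exact_mod_cast hj) h1
      exact_mod_cast h2
    have h0 := h (m / j)
    rw [div_le_iff₀ hj']
    calc c ≤ _ := h0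
      _ ≤ (j : ℝ) ^ 2 * |α - ((m / j : ℚ) : ℝ)| := by gcongr
      _ = |j * (α - m / j)| * j := by
        rw [abs_mul, abs_of_pos hj']; push_cast; ring
      _ = _ := by
        congr 2; field_simp
  constructor
  · have := key ⌊j * α⌋
    rwa [Int.self_sub_floor, abs_of_nonneg (Int.fract_nonneg _)] at this
  · have := key (⌊j * α⌋ + 1)
    rw [abs_sub_comm] at this
    push_cast at this
    rw [abs_of_nonneg (by linarith [Int.lt_floor_add_one ((j : ℝ) * α)])] at this
    have := Int.self_sub_floor ((j : ℝ) * α)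
    linarith

/-! ### Comparison with the grid of multiples of `1 / q` -/

/-- The values of `φ` at the multiples of `1 / q`, continued by `M` to the left of `(0, 1)` and by
`-M` to the right. -/
noncomputable def gridExtension (φ : ℝ → ℝ) (M : ℝ) (q : ℕ) (k : ℤ) : ℝ :=
  if k ≤ 0 then M else if (q : ℤ) ≤ k then -M else φ (k / q)

section grid

variable {φ : ℝ → ℝ} {M : ℝ} {q : ℕ}

theorem intCast_div_mem_Ioo {k : ℤ} (h0 : 0 < k) (hk : k < q) :
    (k / q : ℝ) ∈ Set.Ioo (0 : ℝ) 1 := by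
  have h1 : (0 : ℝ) < k := by exact_mod_cast h0
  have h2 : (k : ℝ) < q := by exact_mod_cast hk
  exact ⟨div_pos h1 (h1.trans h2), (div_lt_one (h1.trans h2)).2 h2⟩

theorem abs_gridExtension_le (hM0 : 0 ≤ M) (hM : ∀ k : ℤ, 0 < k → k < q → |φ (k / q)| ≤ M) (k : ℤ) :
    |gridExtension φ M q k| ≤ M := by
  unfold gridExtension
  split_ifs with h1 h2
  · rw [abs_of_nonneg hM0]
  · rw [abs_neg, abs_of_nonneg hM0]
  · exact hM k (by omega) (by omega)

theorem gridExtension_antitone (hmono : AntitoneOn φ (Set.Ioo 0 1)) (hM0 : 0 ≤ M)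
    (hM : ∀ k : ℤ, 0 < k → k < q → |φ (k / q)| ≤ M) : Antitone (gridExtension φ M q) := by
  intro k l hkl
  have hk := abs_le.1 (abs_gridExtension_le hM0 hM k)
  have hl := abs_le.1 (abs_gridExtension_le hM0 hM l)
  by_cases h1 : k ≤ 0
  · rw [show gridExtension φ M q k = M from if_pos h1]
    exact hl.2
  by_cases h2 : (q : ℤ) ≤ l
  · rw [show gridExtension φ M q l = -M by simp [gridExtension, h2]; omega]
    exact hk.1
  · have e1 : gridExtension φ M q k = φ (k / q) := by
      rw [gridExtension, if_neg h1, if_neg (by omega)]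
    have e2 : gridExtension φ M q l = φ (l / q) := by
      rw [gridExtension, if_neg (by omega), if_neg h2]
    rw [e1, e2]
    refine hmono (intCast_div_mem_Ioo (by omega) (by omega))
      (intCast_div_mem_Ioo (by omega) (by omega)) ?_
    gcongr

/-- The terms `k` and `q - k` cancel by antisymmetry, which leaves only `k = 0`. -/
theorem sum_gridExtension (hanti : ∀ x ∈ Set.Ioo (0 : ℝ) 1, φ (1 - x) = -φ x) (hq : 0 < q) :
    ∑ k ∈ range q, gridExtension φ M q k = M := by
  have hrefl : ∀ k : ℤ, 0 ≤ k → k < q →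
      gridExtension φ M q (q - 1 - k) = -gridExtension φ M q (k + 1) := fun k h0 hk => by
    rcases eq_or_ne (k + 1) q with h | h
    · simp [gridExtension, show (q : ℤ) - 1 - k = 0 by omega, h, hq.ne']
    · have e1 : gridExtension φ M q (q - 1 - k) = φ (((q - 1 - k : ℤ) : ℝ) / q) := by
        rw [gridExtension, if_neg (by omega), if_neg (by omega)]
      have e2 : gridExtension φ M q (k + 1) = φ (((k + 1 : ℤ) : ℝ) / q) := by
        rw [gridExtension, if_neg (by omega), if_neg (by omega)]
      rw [e1, e2, ← hanti _ (intCast_div_mem_Ioo (by omega) (by omega))]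
      congr 1
      have : (q : ℝ) ≠ 0 := by exact_mod_cast hq.ne'
      push_cast
      field_simp
      ring
  have h1 : ∑ k ∈ range q, gridExtension φ M q k =
      -∑ k ∈ range q, gridExtension φ M q (k + 1) := by
    rw [← sum_range_reflect, ← sum_neg_distrib]
    refine sum_congr rfl fun k hk => ?_
    rw [mem_range] at hk
    rw [← hrefl k (by omega) (by omega)]
    congr 1
    omega
  have h2 := sum_range_succ (fun k : ℕ => gridExtension φ M q k) q
  rw [sum_range_succ'] at h2
  have e0 : gridExtension φ M q ((0 : ℕ) : ℤ) = M := by simp [gridExtension]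
  have eq : gridExtension φ M q (q : ℤ) = -M := by simp [gridExtension, hq.ne']
  rw [e0, eq] at h2
  push_cast at h2
  linarith

/-- A point at distance about `1 / q` from `k / q` on the circle has a value of `φ` near the grid
value, unless `k / q` is near an integer. -/
theorem abs_sub_gridExtension_le (hmono : AntitoneOn φ (Set.Ioo 0 1)) (hM0 : 0 ≤ M)
    (hM : ∀ k : ℤ, 0 < k → k < q → |φ (k / q)| ≤ M) {x e : ℝ} (hx : x ∈ Set.Ioo (0 : ℝ) 1)
    (hφx : |φ x| ≤ M) {k : ℕ} (hk : k < q) {t : ℤ} (hxe : q * x = k + e + q * t)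
    (he1 : -1 ≤ e) (he2 : e ≤ 2) :
    |φ x - gridExtension φ M q k| ≤
      (gridExtension φ M q (k - 1) - gridExtension φ M q (k + 2)) +
        ((if k = 0 then 2 * M else 0) + (if k = q - 1 then 2 * M else 0) +
          (if k = q - 2 then 2 * M else 0)) := by
  have hanti := gridExtension_antitone hmono hM0 hM
  have hd1 : gridExtension φ M q k ≤ gridExtension φ M q (k - 1) := hanti (by omega)
  have hd2 : gridExtension φ M q (k + 2) ≤ gridExtension φ M q k := hanti (by omega)
  -- At these three indices, close to an integer, both values are merely bounded by `M`.
  by_cases hex : k = 0 ∨ k = q - 1 ∨ k = q - 2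
  · have h2 : 2 * M ≤ (if k = 0 then 2 * M else 0) + (if k = q - 1 then 2 * M else 0) +
          (if k = q - 2 then 2 * M else 0) := by
      split_ifs <;> first | linarith | (exfalso; tauto)
    have := abs_sub (φ x) (gridExtension φ M q k)
    have := abs_gridExtension_le hM0 hM k
    linarith
  · push Not at hex
    rw [if_neg hex.1, if_neg hex.2.1, if_neg hex.2.2]
    have hqk : k + 3 ≤ q := by omega
    have hqk' : (k : ℝ) + 3 ≤ q := by exact_mod_cast hqk
    have hk1 : (1 : ℝ) ≤ k := by exact_mod_cast Nat.one_le_iff_ne_zero.2 hex.1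
    have hq0 : (0 : ℝ) < q := by linarith
    -- Here `1 ≤ k ≤ q - 3`, so `0 ≤ k + e ≤ q - 1` and there is no wrapping round the circle.
    have ht : t = 0 := by
      have h1 : (q : ℝ) * t < q * 1 := by nlinarith [hx.2]
      have h2 : (q : ℝ) * (-1) < q * t := by nlinarith [hx.1]
      have h3 : (t : ℝ) < 1 := lt_of_mul_lt_mul_left h1 hq0.le
      have h4 : (-1 : ℝ) < t := lt_of_mul_lt_mul_left h2 hq0.le
      have h5 : t < 1 := by exact_mod_cast h3
      have h6 : -1 < t := by exact_mod_cast h4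
      omega
    rw [ht, Int.cast_zero, mul_zero, add_zero] at hxe
    have hφ := abs_le.1 hφx
    have hu : φ x ≤ gridExtension φ M q (k - 1) := by
      unfold gridExtension
      rw [if_neg (show ¬ (q : ℤ) ≤ k - 1 by omega)]
      split_ifs with h
      · exact hφ.2
      · refine hmono (intCast_div_mem_Ioo (by omega) (by omega)) hx ?_
        rw [div_le_iff₀ hq0]
        push_cast
        linarith
    have hl : gridExtension φ M q (k + 2) ≤ φ x := by
      unfold gridExtension
      rw [if_neg (show ¬ (k : ℤ) + 2 ≤ 0 by omega)]
      split_ifs with h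
      · exact hφ.1
      · refine hmono hx (intCast_div_mem_Ioo (by omega) (by omega)) ?_
        rw [le_div_iff₀ hq0]
        push_cast
        linarith
    rw [abs_le]
    constructor <;> linarith

/-- If `x 0, …, x (q - 1)` are points near `0 / q, …, (q - 1) / q` on the circle, then the sum of
`φ` over them is at most a constant times the largest value. -/
theorem abs_sum_le_of_near_grid (hmono : AntitoneOn φ (Set.Ioo 0 1))
    (hanti : ∀ x ∈ Set.Ioo (0 : ℝ) 1, φ (1 - x) = -φ x) (hq : 0 < q)
    (hM : ∀ k : ℤ, 0 < k → k < q → |φ (k / q)| ≤ M) {x : ℕ → ℝ} {σ : ℕ → ℕ}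
    (hσ : Set.BijOn σ (range q) (range q))
    (hx : ∀ r < q, x r ∈ Set.Ioo (0 : ℝ) 1) (hφx : ∀ r < q, |φ (x r)| ≤ M)
    (hnear : ∀ r < q, ∃ (e : ℝ) (t : ℤ), -1 ≤ e ∧ e ≤ 2 ∧ q * x r = σ r + e + q * t) :
    |∑ r ∈ range q, φ (x r)| ≤ 13 * M := by
  have hM0 : 0 ≤ M := (abs_nonneg _).trans (hφx 0 hq)
  have hreindex : ∀ F : ℕ → ℝ, ∑ r ∈ range q, F (σ r) = ∑ k ∈ range q, F k := fun F =>
    sum_bij (fun r _ => σ r) (fun r hr => by simpa using hσ.mapsTo (by simpa using hr))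
      (fun a ha b hb h => hσ.injOn (by simpa using ha) (by simpa using hb) h)
      (fun b hb => by
        obtain ⟨a, ha, hab⟩ := hσ.surjOn (show b ∈ (range q : Set ℕ) by simpa using hb)
        exact ⟨a, by simpa using ha, hab⟩)
      (fun _ _ => rfl)
  set h : ℤ → ℝ := gridExtension φ M q with hh
  have hbd : ∀ k, h k ≤ M ∧ -M ≤ h k := fun k =>
    ⟨(abs_le.1 (abs_gridExtension_le hM0 hM k)).2, (abs_le.1 (abs_gridExtension_le hM0 hM k)).1⟩
  let E : ℕ → ℝ := fun k => (h (k - 1) - h (k + 2)) +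
        ((if k = 0 then 2 * M else 0) + (if k = q - 1 then 2 * M else 0) +
          (if k = q - 2 then 2 * M else 0))
  have hpt : ∀ r ∈ range q, |φ (x r) - h (σ r)| ≤ E (σ r) := fun r hr => by
    have hr' := mem_range.1 hr
    obtain ⟨e, t, he1, he2, hxe⟩ := hnear r hr'
    exact abs_sub_gridExtension_le hmono hM0 hM (hx r hr') (hφx r hr')
      (by simpa using hσ.mapsTo (show r ∈ (range q : Set ℕ) by simpa using hr')) hxe he1 he2
  have hite : ∀ a : ℕ, ∑ k ∈ range q, (if k = a then 2 * M else 0) ≤ 2 * M := fun a => by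
    rw [sum_ite_eq']
    split_ifs <;> linarith
  -- The summand is a first difference of `h (k - 1) + h k + h (k + 1)`, so six values of `h`
  -- remain.
  have htel : ∑ k ∈ range q, (h ((k : ℤ) - 1) - h (k + 2)) ≤ 6 * M := by
    have := sum_range_sub' (fun k : ℕ => h ((k : ℤ) - 1) + h k + h (k + 1)) q
    have h2 : ∑ k ∈ range q, (h ((k : ℤ) - 1) - h (k + 2)) =
        ∑ k ∈ range q, ((h ((k : ℤ) - 1) + h k + h (k + 1)) -
          (h (((k + 1 : ℕ) : ℤ) - 1) + h ((k + 1 : ℕ) : ℤ) + h (((k + 1 : ℕ) : ℤ) + 1))) := by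
      refine sum_congr rfl fun k _ => ?_
      push_cast
      rw [show (k : ℤ) + 1 - 1 = k by ring, show (k : ℤ) + 1 + 1 = k + 2 by ring]
      ring
    rw [h2, this]
    linarith [hbd (((0 : ℕ) : ℤ) - 1), hbd ((0 : ℕ) : ℤ), hbd (((0 : ℕ) : ℤ) + 1),
      hbd ((q : ℤ) - 1), hbd q, hbd ((q : ℤ) + 1)]
  have hE : ∑ k ∈ range q, E k ≤ 12 * M := by
    simp only [E, sum_add_distrib]
    linarith [hite 0, hite (q - 1), hite (q - 2)]
  -- The `12` is `6` from telescoping plus `2` for each exceptional index; the grid sum `M` itself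
  -- makes it `13`.
  have hdiff : |∑ r ∈ range q, φ (x r) - M| ≤ 12 * M := by
    have hsum : ∑ r ∈ range q, φ (x r) - M = ∑ r ∈ range q, (φ (x r) - h (σ r)) := by
      rw [sum_sub_distrib, hreindex (fun k => h k), hh, sum_gridExtension hanti hq]
    rw [hsum]
    calc _ ≤ ∑ r ∈ range q, |φ (x r) - h (σ r)| := abs_sum_le_sum_abs _ _
      _ ≤ ∑ r ∈ range q, E (σ r) := sum_le_sum hpt
      _ = ∑ k ∈ range q, E k := hreindex E
      _ ≤ 12 * M := hE
  rw [abs_le] at hdiff ⊢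
  constructor <;> linarith

end grid

/-! ### Blocks of the orbit -/

/-- Since `p` is invertible modulo `q`, the rotation by `p / q` visits every grid point once in `q`
steps. -/
theorem bijOn_toNat_emod {q : ℕ} (hq : 0 < q) {p : ℤ} (hpq : IsCoprime p q) (m : ℤ) :
    Set.BijOn (fun r : ℕ => ((m + r * p) % q).toNat) (range q) (range q) := by
  have hq' : (q : ℤ) ≠ 0 := by omega
  have hmaps : Set.MapsTo (fun r : ℕ => ((m + r * p) % q).toNat) (range q) (range q) := by
    intro r _
    have h1 := Int.emod_nonneg (m + r * p) hq'
    have h2 := Int.emod_lt_of_pos (m + r * p) (show (0 : ℤ) < q by omega)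
    simp only [coe_range, Set.mem_Iio]
    omega
  have hinj : Set.InjOn (fun r : ℕ => ((m + r * p) % q).toNat) (range q) := by
    intro a ha b hb hab
    simp only [coe_range, Set.mem_Iio] at ha hb hab
    have h1 := Int.emod_nonneg (m + a * p) hq'
    have h2 := Int.emod_nonneg (m + b * p) hq'
    have h3 : (m + a * p) % q = (m + b * p) % q := by omega
    have h4 : (q : ℤ) ∣ (a - b) * p := by
      convert Int.ModEq.dvd (Int.ModEq.symm h3) using 1
      ring
    have h5 : (q : ℤ) ∣ a - b := hpq.symm.dvd_of_dvd_mul_right h4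
    have h6 : (a : ℤ) - b = 0 := Int.eq_zero_of_abs_lt_dvd h5 (by rw [abs_lt]; omega)
    omega
  exact ⟨hmaps, hinj, surjOn_of_injOn_of_card_le _ hmaps hinj le_rfl⟩

/-- The sum over a block of `q` consecutive multiples of `α`, where `p / q` is a good
approximation of `α`. -/
theorem abs_sum_block_le {φ : ℝ → ℝ} (hmono : AntitoneOn φ (Set.Ioo 0 1))
    (hanti : ∀ x ∈ Set.Ioo (0 : ℝ) 1, φ (1 - x) = -φ x) {α M : ℝ} {q : ℕ} (hq : 0 < q) {p : ℤ}
    (hpq : IsCoprime p q) (happrox : q * |q * α - p| ≤ 1)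
    (hM : ∀ k : ℤ, 0 < k → k < q → |φ (k / q)| ≤ M) (s : ℕ)
    (hx : ∀ r < q, Int.fract (((s + r : ℕ) : ℝ) * α) ∈ Set.Ioo (0 : ℝ) 1)
    (hφx : ∀ r < q, |φ (Int.fract (((s + r : ℕ) : ℝ) * α))| ≤ M) :
    |∑ r ∈ range q, φ (Int.fract (((s + r : ℕ) : ℝ) * α))| ≤ 13 * M := by
  set m : ℤ := ⌊q * (s * α)⌋ with hm
  refine abs_sum_le_of_near_grid (x := fun r => Int.fract (((s + r : ℕ) : ℝ) * α)) hmono hanti hq hM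
    (bijOn_toNat_emod hq hpq m) hx hφx fun r hr => ?_
  have hr' : (r : ℝ) ≤ q := by exact_mod_cast hr.le
  have hδ : |r * (q * α - p)| ≤ 1 := by
    rw [abs_mul, Nat.abs_cast]
    exact (mul_le_mul_of_nonneg_right hr' (abs_nonneg _)).trans happrox
  have hδ' := abs_le.1 hδ
  have hθ0 := Int.fract_nonneg (q * (s * α))
  have hθ1 := Int.fract_lt_one (q * (s * α))
  -- From `q (s + r) α = (m + r p) + fract (q s α) + r (q α - p)`: the last two terms lie in `[0,
  -- 1)` and `[-1, 1]`. The integer `t` records the reduction of `m + r p` modulo `q` and of `(s +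
  -- r) α` modulo `1`.
  refine ⟨Int.fract (q * (s * α)) + r * (q * α - p),
    (m + r * p) / q - ⌊((s + r : ℕ) : ℝ) * α⌋, by linarith, by linarith, ?_⟩
  have h1 : ((((m + r * p) % q).toNat : ℕ) : ℝ) = (((m + r * p) % q : ℤ) : ℝ) := by
    have := Int.toNat_of_nonneg (Int.emod_nonneg (m + r * p) (show (q : ℤ) ≠ 0 by omega))
    exact_mod_cast this
  have h2 : (((m + r * p) % q : ℤ) : ℝ) + q * (((m + r * p) / q : ℤ) : ℝ) = m + r * p := by
    exact_mod_cast Int.emod_add_mul_ediv (m + r * p) q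
  have h3 := Int.self_sub_floor (q * (s * α))
  have h4 := Int.self_sub_floor (((s + r : ℕ) : ℝ) * α)
  rw [h1, ← h4, ← h3, ← hm, Int.cast_sub]
  push_cast at h2 ⊢
  linear_combination (-1 : ℝ) * h2

/-! ### Size of `φ` and the induction on `N` -/

/-- Antisymmetry carries the growth bound over to the right half and forces `φ (1 / 2) = 0`. -/
theorem abs_le_div_of_mem_Icc {φ : ℝ → ℝ} (hanti : ∀ x ∈ Set.Ioo (0 : ℝ) 1, φ (1 - x) = -φ x)
    {K : ℝ} (hK : 0 ≤ K) (hgrowth : ∀ x ∈ Set.Ioo (0 : ℝ) (1 / 2), |φ x| ≤ K * (1 / x)) {d x : ℝ}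
    (hd : 0 < d) (hx : x ∈ Set.Icc d (1 - d)) : |φ x| ≤ K / d := by
  obtain ⟨h1, h2⟩ := hx
  have key : ∀ y, d ≤ y → y < 1 / 2 → |φ y| ≤ K / d := fun y hy hy2 => by
    refine (hgrowth y ⟨by linarith, hy2⟩).trans ?_
    rw [mul_one_div]
    gcongr
  rcases lt_trichotomy x (1 / 2) with h | h | h
  · exact key x h1 h
  · have := hanti (1 / 2) (by norm_num)
    norm_num at this
    have h0 : φ (1 / 2) = 0 := by norm_num; linarith
    rw [h, h0, abs_zero]
    positivity
  · have := hanti x ⟨by linarith, by linarith⟩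
    rw [← abs_neg, ← this]
    exact key _ (by linarith) (by linarith)

theorem rotationSum_add (α : ℝ) (φ : ℝ → ℝ) (n q : ℕ) :
    rotationSum α φ (n + q) =
      rotationSum α φ n + ∑ r ∈ range q, φ (Int.fract (((n + 1 + r : ℕ) : ℝ) * α)) := by
  induction q with
  | zero => simp
  | succ q ih =>
    rw [sum_range_succ, ← add_assoc (rotationSum α φ n), ← ih, rotationSum, rotationSum, ← add_assoc,
      sum_Icc_succ_top (by omega)]
    rw [show n + q + 1 = n + 1 + q by omega]

theorem mainTheorem3 (α : ℝ) (hα : IsConstantType α) (φ : ℝ → ℝ)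
    (hmono : AntitoneOn φ (Set.Ioo 0 1))
    (hanti : ∀ x ∈ Set.Ioo (0 : ℝ) 1, φ (1 - x) = -φ x)
    (hgrowth : ∃ K : ℝ, ∀ x ∈ Set.Ioo (0 : ℝ) (1 / 2), |φ x| ≤ K * (1 / x)) :
    ∃ C : ℝ, ∀ N : ℕ, |rotationSum α φ N| ≤ C * (N : ℝ) := by
  obtain ⟨K, hgrowth⟩ := hgrowth
  have hK : 0 ≤ K := by
    have := (abs_nonneg _).trans (hgrowth (1 / 4) (by norm_num))
    linarith
  obtain ⟨c, hc, hc1, hbad⟩ := hα.exists_le_abs_sub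
  -- One factor `1 / c` comes from `M = K N / c`, the other from `N ≤ q / c`.
  refine ⟨13 * K / c ^ 2, fun N => ?_⟩
  induction N using Nat.strong_induction_on with
  | _ N ih =>
  rcases N.eq_zero_or_pos with rfl | hN
  · simp [rotationSum]
  obtain ⟨x, hx, hxN⟩ := Real.exists_rat_abs_sub_le_and_den_le α hN
  have hq : 0 < x.den := x.pos
  have hq' : (0 : ℝ) < x.den := by exact_mod_cast hq
  have hN' : (0 : ℝ) < N := by exact_mod_cast hN
  have hxN' : (x.den : ℝ) ≤ N := by exact_mod_cast hxN
  -- Bad approximability against Dirichlet: `c ≤ q² |α - x| ≤ q / (N + 1)`.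
  have hcN : c * N ≤ x.den := by
    have h1 : c ≤ (x.den : ℝ) ^ 2 * (1 / ((N + 1) * x.den)) := (hbad x).trans (by gcongr)
    have h2 : (x.den : ℝ) ^ 2 * (1 / ((N + 1) * x.den)) = x.den / (N + 1) := by field_simp
    rw [h2, le_div_iff₀ (by positivity)] at h1
    linarith
  have happrox : x.den * |x.den * α - x.num| ≤ 1 := by
    have h1 : (x.den : ℝ) * α - x.num = x.den * (α - x) := by
      rw [mul_sub, mul_comm _ (x : ℝ)]
      congr 1
      exact_mod_cast (Rat.mul_den_eq_num x).symm
    rw [h1, abs_mul, Nat.abs_cast]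
    calc (x.den : ℝ) * (x.den * |α - x|) ≤ x.den * (x.den * (1 / ((N + 1) * x.den))) := by gcongr
      _ = x.den / (N + 1) := by field_simp
      _ ≤ 1 := by rw [div_le_one (by positivity)]; linarith
  -- The block consists of the times `n + 1, …, N`; none exceeds `N`, so one bound `M` serves all of
  -- them.
  obtain ⟨n, rfl⟩ : ∃ n, N = n + x.den := ⟨N - x.den, by omega⟩
  set N : ℝ := ((n + x.den : ℕ) : ℝ) with hNdef
  have hdN : 0 < c / N := by positivity
  have hpts : ∀ r < x.den, Int.fract (((n + 1 + r : ℕ) : ℝ) * α) ∈ Set.Icc (c / N) (1 - c / N) := by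
    intro r hr
    have h1 := fract_mul_mem_Icc hbad (show 0 < n + 1 + r by omega)
    have h2 : ((n + 1 + r : ℕ) : ℝ) ≤ N := by
      rw [hNdef]; exact_mod_cast (show n + 1 + r ≤ n + x.den by omega)
    have h3 : (0 : ℝ) < ((n + 1 + r : ℕ) : ℝ) := by positivity
    have h4 : c / N ≤ c / ((n + 1 + r : ℕ) : ℝ) := by gcongr
    exact ⟨h4.trans h1.1, h1.2.trans (by linarith)⟩
  have hgrid : ∀ k : ℤ, 0 < k → k < x.den → |φ (k / x.den)| ≤ K / (c / N) := by
    intro k h0 hk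
    have h1 : (1 : ℝ) ≤ k := by exact_mod_cast h0
    have h2 : (k : ℝ) + 1 ≤ x.den := by exact_mod_cast hk
    have h3 : c / N ≤ 1 / x.den := by gcongr
    have h4 : (1 : ℝ) / x.den ≤ k / x.den := by gcongr
    have h5 : (k : ℝ) / x.den ≤ 1 - 1 / x.den := by
      rw [le_sub_iff_add_le, ← add_div, div_le_one hq']
      exact h2
    exact abs_le_div_of_mem_Icc hanti hK hgrowth hdN ⟨by linarith, by linarith⟩
  have hblock := abs_sum_block_le (M := K / (c / N)) hmono hanti hq
    (p := x.num) (Rat.isCoprime_num_den x) happrox hgrid (n + 1)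
    (fun r hr => ⟨hdN.trans_le (hpts r hr).1, (hpts r hr).2.trans_lt (by linarith)⟩)
    (fun r hr => abs_le_div_of_mem_Icc hanti hK hgrowth hdN (hpts r hr))
  have hMle : 13 * (K / (c / N)) ≤ 13 * K / c ^ 2 * x.den := by
    calc 13 * (K / (c / N)) = 13 * K / c ^ 2 * (c * N) := by field_simp
      _ ≤ _ := by gcongr
  rw [rotationSum_add]
  have hih := ih n (by omega)
  calc _ ≤ |rotationSum α φ n| + _ := abs_add_le _ _
    _ ≤ 13 * K / c ^ 2 * n + 13 * K / c ^ 2 * x.den := add_le_add hih (hblock.trans hMle)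
    _ = 13 * K / c ^ 2 * N := by rw [hNdef]; push_cast; ring
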